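/- Let $n$ be an integer and let $Z_n=\operatorname{Tot}\mathcal O_{\mathbb P^1}(-n)$ be the complex surface obtained by gluing two copies of $\mathbb C^2$, with coordinates $(z,u)$ and $(\xi,v)$, along $z\neq 0$, $\xi\ne 0$ by $(\xi,v)=(z^{-1},z^n u)$. Let $\ell\simeq\mathbb P^1$ be its zero section ($u=0$, respectively $v=0$), and let $Z_n^o=Z_n\setminus\ell$ be the collar, with the analytic topology. Then $Z_n^o$ is homotopy equivalent to the total space of an $S^1$-bundle over $S^2$ (with structure group $SO(2)\simeq S^1$) whose gluing map has degree $n$: writing $S^2=D^+\cup D^-$ as the union of the upper and lower hemispheres, the bundle has trivializations over neighbourhoods of $D^+$ and $D^-$ whose fibre coordinates along the equator, parametrized by $z\in S^1=\partial D^+$, are related by $s\mapsto g(z)\,s$ with $g\colon S^1\to SO(2)\simeq S^1$ continuous of degree $n\in\pi_1(SO(2))=\mathbb Z$. Moreover $\pi_1(Z_n^o)\cong\mathbb Z/n\mathbb Z$ (for every base point; for $n=0$ this group is $\mathbb Z$). -/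

import Mathlib

open scoped ContinuousMap

/-- The gluing relation between the two charts `U = ℂ²` (coordinates `(z, u)`) and
`V = ℂ²` (coordinates `(ξ, v)`): `z ≠ 0` and `(ξ, v) = (z⁻¹, zⁿ u)`. -/
def ChartGlue (n : ℤ) (p q : ℂ × ℂ) : Prop :=
  p.1 ≠ 0 ∧ q = (p.1⁻¹, p.1 ^ n * p.2)

theorem ChartGlue.right_unique {n : ℤ} {p q q' : ℂ × ℂ} (h : ChartGlue n p q)
    (h' : ChartGlue n p q') : q = q' :=
  h.2.trans h'.2.symm

theorem ChartGlue.left_unique {n : ℤ} {p p' q : ℂ × ℂ} (h : ChartGlue n p q)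
    (h' : ChartGlue n p' q) : p = p' := by
  obtain ⟨h0, h1⟩ := h
  obtain ⟨-, h1'⟩ := h'
  rw [h1, Prod.mk.injEq, inv_inj] at h1'
  obtain ⟨ha, hb⟩ := h1'
  rw [← ha] at hb
  exact Prod.ext ha (mul_left_cancel₀ (zpow_ne_zero n h0) hb)

/-- The equivalence relation on the disjoint union `U ⊔ V` that identifies points
related by `ChartGlue`. -/
def surfaceSetoid (n : ℤ) : Setoid ((ℂ × ℂ) ⊕ (ℂ × ℂ)) where
  r a b := match a, b with
    | .inl p, .inl q => p = q
    | .inr p, .inr q => p = q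
    | .inl p, .inr q => ChartGlue n p q
    | .inr q, .inl p => ChartGlue n p q
  iseqv :=
    { refl := by rintro (p | p) <;> rfl
      symm := by
        rintro (p | p) (q | q) h
        · exact Eq.symm h
        · exact h
        · exact h
        · exact Eq.symm h
      trans := by
        rintro (p | p) (q | q) (r | r) h h'
        · exact Eq.trans h h'
        · cases (show p = q from h); exact h'
        · exact ChartGlue.left_unique h h'
        · cases (show q = r from h'); exact h
        · cases (show q = r from h'); exact h
        · exact ChartGlue.right_unique h h'
        · cases (show p = q from h); exact h'
        · exact Eq.trans h h' }

/-- The surface `Z_n`, the total space of the line bundle `𝒪(-n)` over the complex projective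
line, with its analytic topology: two copies of `ℂ²` glued by `(ξ, v) = (z⁻¹, zⁿ u)`. -/
def LocalSurface (n : ℤ) : Type := Quotient (surfaceSetoid n)

instance (n : ℤ) : TopologicalSpace (LocalSurface n) :=
  inferInstanceAs (TopologicalSpace (Quotient (surfaceSetoid n)))

/-- The point of `Z_n` with canonical coordinates `(z, u)` in the first chart. -/
def LocalSurface.ofU (n : ℤ) (p : ℂ × ℂ) : LocalSurface n :=
  Quotient.mk (surfaceSetoid n) (Sum.inl p)

/-- The point of `Z_n` with canonical coordinates `(ξ, v)` in the second chart. -/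
def LocalSurface.ofV (n : ℤ) (q : ℂ × ℂ) : LocalSurface n :=
  Quotient.mk (surfaceSetoid n) (Sum.inr q)

/-- The zero section `ℓ ≅ ℙ¹` of `Z_n`, given by `u = 0` and `v = 0` in the two charts. -/
def zeroSection (n : ℤ) : Set (LocalSurface n) :=
  Set.range (fun z : ℂ => LocalSurface.ofU n (z, 0)) ∪
    Set.range (fun ξ : ℂ => LocalSurface.ofV n (ξ, 0))

/-- The collar `Z_n^o`, the complement of the zero section in `Z_n`. -/
def collar (n : ℤ) : Set (LocalSurface n) := (zeroSection n)ᶜ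

/-- The two-sphere. -/
abbrev TwoSphere : Type := Metric.sphere (0 : EuclideanSpace ℝ (Fin 3)) 1

/-- The north pole `(0, 0, 1)`, the centre of the hemisphere `D⁺`. -/
noncomputable def northPole : TwoSphere :=
  ⟨!₂[0, 0, 1], by simp [EuclideanSpace.norm_eq, Fin.sum_univ_three]⟩

/-- The south pole `(0, 0, -1)`, the centre of the hemisphere `D⁻`. -/
noncomputable def southPole : TwoSphere :=
  ⟨!₂[0, 0, -1], by simp [EuclideanSpace.norm_eq, Fin.sum_univ_three]⟩

/-- The equator, parametrized by the unit circle as the positively oriented boundary of `D⁺`. -/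
noncomputable def equator (z : Circle) : TwoSphere :=
  ⟨!₂[(z : ℂ).re, (z : ℂ).im, 0], by
    have h : (z : ℂ).re ^ 2 + (z : ℂ).im ^ 2 = 1 := by
      have := Circle.normSq_coe z
      rw [Complex.normSq_apply] at this
      nlinarith
    simp [EuclideanSpace.norm_eq, Fin.sum_univ_three, h]⟩

/-- A self-map `g` of the circle has degree `n`: it lifts to a continuous `φ : ℝ → ℝ` on angles
which increases by `2πn` around the circle. -/
def HasCircleDegree (g : Circle → Circle) (n : ℤ) : Prop :=
  ∃ φ : ℝ → ℝ, Continuous φ ∧ (∀ t, g (Circle.exp t) = Circle.exp (φ t)) ∧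
    ∀ t, φ (t + 2 * Real.pi) = φ t + 2 * Real.pi * n

/-- `p : E → S²` is an `S¹`-bundle with structure group `SO(2) = S¹` whose gluing map has degree
`n`: there are local trivializations `e₁` around `D⁺` (over the complement of the south pole) and
`e₂` around `D⁻` (over the complement of the north pole), on the overlap they differ by a rotation
`τ b` of the fibre over `b`, and the gluing map `τ` along the equator has degree `n`. -/
def IsCircleBundleOfDegree {E : Type*} [TopologicalSpace E] (p : E → TwoSphere) (n : ℤ) : Prop :=
  ∃ e₁ e₂ : Bundle.Trivialization Circle p,
    e₁.baseSet = {southPole}ᶜ ∧ e₂.baseSet = {northPole}ᶜ ∧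
    ∃ τ : TwoSphere → Circle,
      (∀ b, b ≠ southPole → b ≠ northPole → ∀ s : Circle, e₁.coordChange e₂ b s = τ b * s) ∧
      HasCircleDegree (fun z => τ (equator z)) n

/-! The line bundle carries the Hermitian norm `(1 + |z|²)^(n/2) |u|`, which is compatible with the
gluing. Dividing by it retracts the collar onto the unit circle bundle (`collarHomotopyEquiv`). In
phase coordinates the moduli drop out of the transition `u ↦ zⁿ u`, leaving multiplication by
`(z/|z|)ⁿ`, which has degree `n` on the equator (`circleChart_ofU_eq_circleChart_ofV`).

The fundamental group is the deck group of a simply connected covering. For `n ≠ 0` this covering is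
`ℂ² ∖ 0`, the collar of `𝒪(-1)`, mapped by the fibrewise `n`-th power `(a, b) ↦ (b/a, aⁿ)`; its
fibres are the orbits of the `|n|`-th roots of unity acting by scalars
(`isQuotientCoveringMap_collarPowMap`). For `n = 0` the collar is `S² × ℂ*`, covered by `S² × ℂ`
through the exponential, with deck group `2πiℤ`.

Both coverings rest on the simple connectedness of `E ∖ 0` for `dim E > 2`: a loop is deformed to a
polynomial one, which misses a ray for dimension reasons, and the complement of a ray is
star-shaped. -/

/-! ### Simple connectedness of punctured vector spaces and of the two-sphere -/

open scoped unitInterval in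
theorem Path.Homotopic.of_forall_lineMap_ne_zero {E : Type*} [NormedAddCommGroup E]
    [NormedSpace ℝ E] {x y : {v : E // v ≠ 0}} (p q : Path x y)
    (h : ∀ s t : I, AffineMap.lineMap (p t : E) (q t : E) (s : ℝ) ≠ 0) : p.Homotopic q :=
  ⟨{toFun := fun a => ⟨AffineMap.lineMap (p a.2 : E) (q a.2 : E) (a.1 : ℝ), h a.1 a.2⟩
    continuous_toFun := by
      simp only [AffineMap.lineMap_apply_module]
      fun_prop
    map_zero_left := fun t => by simp
    map_one_left := fun t => by simp
    prop' := by
      rintro s t (rfl | rfl) <;> simp}⟩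

/-- The cone over a polynomial curve is the image of a `C¹` map from `ℝ²`, so in dimension above two
its complement is dense. Letting `c` run over all reals makes the curve miss every positive multiple
of `w`. -/
theorem exists_forall_smul_bernsteinApproximation_ne {E : Type*} [NormedAddCommGroup E]
    [NormedSpace ℝ E] [FiniteDimensional ℝ E] (h : 2 < Module.finrank ℝ E) (n : ℕ)
    (f : C(unitInterval, E)) :
    ∃ w : E, ∀ (c : ℝ) (t : unitInterval), c • bernsteinApproximation n f t ≠ w := by
  let F : ℝ × ℝ → E := fun a => a.1 • ∑ k : Fin (n + 1),
    ((n.choose k : ℝ) * a.2 ^ (k : ℕ) * (1 - a.2) ^ (n - k)) • f (bernstein.z k)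
  have hF : ContDiff ℝ 1 F := by
    refine contDiff_fst.smul (ContDiff.sum fun k _ => ContDiff.smul ?_ contDiff_const)
    fun_prop
  have hd := hF.dense_compl_range_of_finrank_lt_finrank (by simpa using h)
  obtain ⟨w, hw⟩ := hd.nonempty
  refine ⟨w, fun c t hc => hw ⟨(c, t), ?_⟩⟩
  simpa [F, bernsteinApproximation.apply, bernstein_apply] using hc

/-- If a point `a • (-w) + b • y` with `b > 0` equals `c • w`, then `y = ((c + a) / b) • w` already
lies on the ray. -/
theorem starConvex_compl_ray {E : Type*} [AddCommGroup E] [Module ℝ E] {w : E} (hw : w ≠ 0) :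
    StarConvex ℝ (-w) {y : E | ∀ c : ℝ, 0 ≤ c → y ≠ c • w} := by
  intro y hy a b ha hb hab c hc h
  rcases hb.eq_or_lt with rfl | hb
  · obtain rfl : a = 1 := by linarith
    have h' : (c + 1) • w = 0 := by
      rw [add_smul, one_smul, ← h]; simp
    rcases smul_eq_zero.1 h' with h' | h'
    · linarith
    · exact hw h'
  · refine hy ((c + a) / b) (by positivity) ?_
    rw [div_eq_inv_mul, mul_smul, add_smul, ← h]
    simp [smul_smul, hb.ne']

theorem simplyConnectedSpace_ne_zero {E : Type*} [NormedAddCommGroup E] [NormedSpace ℝ E]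
    [FiniteDimensional ℝ E] (h : 2 < Module.finrank ℝ E) :
    SimplyConnectedSpace {v : E // v ≠ 0} := by
  have hpc : IsPathConnected ({0}ᶜ : Set E) :=
    isPathConnected_compl_singleton_of_one_lt_rank
      (by rw [← Module.finrank_eq_rank]; exact_mod_cast (by omega)) 0
  refine simply_connected_iff_loops_nullhomotopic.2
    ⟨isPathConnected_iff_pathConnectedSpace.1 hpc, fun x p => ?_⟩
  let f : C(unitInterval, E) := ⟨fun t => p t, by fun_prop⟩
  -- The minimal distance of the loop from the origin is positive; any approximation closer than
  -- this is joined to the loop by segments avoiding the origin.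
  obtain ⟨t₀, -, ht₀⟩ := isCompact_univ.exists_isMinOn (f := fun t => ‖f t‖) Set.univ_nonempty
    (by fun_prop)
  have hδ : 0 < ‖f t₀‖ := norm_pos_iff.2 (p t₀).2
  -- The degree is taken nonzero so that the Bernstein polynomial has its last node at 1 and
  -- interpolates the endpoint.
  obtain ⟨n, hn, hn0⟩ := (((Metric.tendsto_nhds.1 (bernsteinApproximation_uniform f)) _ hδ).and
    (Filter.eventually_ne_atTop 0)).exists
  set b := bernsteinApproximation n f with hb
  have hclose : ∀ t, ‖b t - f t‖ < ‖f t‖ := fun t =>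
    ((dist_eq_norm (b t) (f t)) ▸ (ContinuousMap.dist_apply_le_dist t).trans_lt hn).trans_le
      (ht₀ (Set.mem_univ t))
  have hline : ∀ s t : unitInterval, AffineMap.lineMap (f t) (b t) (s : ℝ) ≠ 0 := by
    intro s t h0
    rw [AffineMap.lineMap_apply_module', add_eq_zero_iff_eq_neg] at h0
    have h1 := congrArg norm h0
    rw [norm_neg, norm_smul, Real.norm_of_nonneg s.2.1] at h1
    nlinarith [hclose t, s.2.2, norm_nonneg (b t - f t)]
  have hb0 : ∀ t, b t ≠ 0 := fun t => by simpa using hline 1 t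
  let q : Path x x :=
    { toFun := fun t => ⟨b t, hb0 t⟩
      continuous_toFun := by fun_prop
      source' := Subtype.ext (by simp [hb, f])
      target' := Subtype.ext (by simp [hb, f, hn0]) }
  refine (Path.Homotopic.of_forall_lineMap_ne_zero p q hline).trans ?_
  obtain ⟨w, hw⟩ := exists_forall_smul_bernsteinApproximation_ne h n f
  have hw0 : w ≠ 0 := by simpa using (hw 0 0).symm
  let S : Set E := {y : E | ∀ c : ℝ, 0 ≤ c → y ≠ c • w}
  have hS : ∀ t, b t ∈ S := by
    intro t c hc h1
    rcases hc.eq_or_lt with rfl | hc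
    · exact hb0 t (by simpa using h1)
    · exact hw c⁻¹ t (by rw [← hb, h1, smul_smul, inv_mul_cancel₀ hc.ne', one_smul])
  have hcont : ContractibleSpace S := (starConvex_compl_ray hw0).contractibleSpace ⟨_, hS 0⟩
  have hx : (x : E) = b 0 := by simp [hb, f]
  -- The polynomial loop is seen as a loop in the contractible ray complement; the inclusion `ι`
  -- carries its contraction back.
  let q' : Path (⟨x, hx ▸ hS 0⟩ : S) ⟨x, hx ▸ hS 0⟩ :=
    { toFun := fun t => ⟨b t, hS t⟩
      continuous_toFun := by fun_prop
      source' := Subtype.ext (by simp [hb, f])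
      target' := Subtype.ext (by simp [hb, f, hn0]) }
  let ι : C(S, {v : E // v ≠ 0}) :=
    ⟨fun y => ⟨y, fun h0 => y.2 0 le_rfl (by simpa using h0)⟩, by fun_prop⟩
  exact (SimplyConnectedSpace.paths_homotopic q' (Path.refl _)).map ι

/-- Radial projection is a homotopy inverse of the inclusion of the unit sphere into the
complement of the origin. -/
noncomputable def unitSphereHomotopyEquiv (E : Type*) [NormedAddCommGroup E] [NormedSpace ℝ E] :
    Metric.sphere (0 : E) 1 ≃ₕ {v : E // v ≠ 0} where
  toFun := ⟨fun v => ⟨v, ne_zero_of_mem_unit_sphere v⟩, by fun_prop⟩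
  invFun := ⟨fun v => ⟨‖(v : E)‖⁻¹ • (v : E), by
      rw [mem_sphere_zero_iff_norm, norm_smul, norm_inv, norm_norm,
        inv_mul_cancel₀ (norm_ne_zero_iff.2 v.2)]⟩, by
    refine Continuous.subtype_mk ?_ _
    exact (continuous_subtype_val.norm.inv₀ fun v => norm_ne_zero_iff.2 v.2).smul
      continuous_subtype_val⟩
  left_inv := by
    convert ContinuousMap.Homotopic.refl _
    ext v
    simp
  right_inv := ⟨{
    toFun := fun a => ⟨((1 - (a.1 : ℝ)) * ‖(a.2 : E)‖⁻¹ + a.1) • (a.2 : E), smul_ne_zero (by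
      have h1 := inv_pos.2 (norm_pos_iff.2 a.2.2)
      have h2 := a.1.2.1
      have h3 := a.1.2.2
      rcases h2.eq_or_lt with h | h
      · rw [← h]; simpa using h1.ne'
      · have := mul_nonneg (sub_nonneg.2 h3) h1.le
        positivity) a.2.2⟩
    continuous_toFun := by
      refine Continuous.subtype_mk ?_ _
      have : Continuous fun a : unitInterval × {v : E // v ≠ 0} => ‖(a.2 : E)‖⁻¹ :=
        (continuous_subtype_val.comp continuous_snd).norm.inv₀ fun v => norm_ne_zero_iff.2 v.2.2
      fun_prop
    map_zero_left := fun v => by ext; simp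
    map_one_left := fun v => by ext; simp }⟩

instance : SimplyConnectedSpace TwoSphere :=
  have := simplyConnectedSpace_ne_zero (E := EuclideanSpace ℝ (Fin 3)) (by simp)
  (unitSphereHomotopyEquiv (EuclideanSpace ℝ (Fin 3))).simplyConnectedSpace

/-! ### Topology of the glued surface, fibrewise scaling and Hermitian norm -/

/-- The inverse transition has the same formula, since `(z⁻¹)ⁿ zⁿ u = u`. Facts about the second
chart thus follow from the first through `swap`. -/
theorem ChartGlue.symm {n : ℤ} {p q : ℂ × ℂ} (h : ChartGlue n p q) : ChartGlue n q p := by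
  obtain ⟨h0, rfl⟩ := h
  refine ⟨inv_ne_zero h0, ?_⟩
  simp [zpow_ne_zero n h0]

namespace LocalSurface

variable {n : ℤ} {Y : Type*}

/-- The projection from the disjoint union of the two charts. -/
def ofCharts (n : ℤ) : (ℂ × ℂ) ⊕ (ℂ × ℂ) → LocalSurface n := Quotient.mk (surfaceSetoid n)

theorem isQuotientMap_ofCharts (n : ℤ) : Topology.IsQuotientMap (ofCharts n) :=
  isQuotientMap_quotient_mk'

theorem continuous_ofU (n : ℤ) : Continuous (ofU n) :=
  (isQuotientMap_ofCharts n).continuous.comp continuous_inl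

theorem continuous_ofV (n : ℤ) : Continuous (ofV n) :=
  (isQuotientMap_ofCharts n).continuous.comp continuous_inr

theorem ofU_injective (n : ℤ) : Function.Injective (ofU n) := fun _ _ h =>
  (Quotient.exact h :)

theorem ofV_injective (n : ℤ) : Function.Injective (ofV n) := fun _ _ h =>
  (Quotient.exact h :)

theorem ofU_eq_ofV_iff {p q : ℂ × ℂ} : ofU n p = ofV n q ↔ ChartGlue n p q :=
  ⟨fun h => (Quotient.exact h :), fun h => Quotient.sound h⟩

theorem ofU_eq_ofV {z : ℂ} (hz : z ≠ 0) (u : ℂ) : ofU n (z, u) = ofV n (z⁻¹, z ^ n * u) :=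
  ofU_eq_ofV_iff.2 ⟨hz, rfl⟩

theorem isOpen_iff {W : Set (LocalSurface n)} :
    IsOpen W ↔ IsOpen (ofU n ⁻¹' W) ∧ IsOpen (ofV n ⁻¹' W) := by
  rw [← (isQuotientMap_ofCharts n).isOpen_preimage, isOpen_sum_iff]
  rfl

/-- A function on the surface given by its expressions in the two charts. -/
def lift (f g : ℂ × ℂ → Y) (h : ∀ p q, ChartGlue n p q → f p = g q) : LocalSurface n → Y :=
  Quotient.lift (Sum.elim f g) (by
    rintro (p | p) (q | q) hpq
    · exact congrArg f hpq
    · exact h p q hpq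
    · exact (h q p hpq).symm
    · exact congrArg g hpq)

theorem continuous_lift [TopologicalSpace Y] {f g : ℂ × ℂ → Y}
    {h : ∀ p q, ChartGlue n p q → f p = g q} (hf : Continuous f) (hg : Continuous g) :
    Continuous (lift f g h) :=
  (hf.sumElim hg).quotient_lift _

@[elab_as_elim]
theorem chartCases {C : LocalSurface n → Prop} (hU : ∀ p, C (ofU n p)) (hV : ∀ q, C (ofV n q))
    (x : LocalSurface n) : C x := by
  induction x using Quotient.inductionOn with
  | h p => rcases p with p | p; exacts [hU p, hV p]

@[elab_as_elim]
theorem chartCases' {C : LocalSurface n → Prop} (hU : ∀ z u, C (ofU n (z, u)))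
    (hV : ∀ v, C (ofV n (0, v))) (x : LocalSurface n) : C x := by
  induction x using chartCases with
  | hU p => exact hU p.1 p.2
  | hV q =>
    obtain ⟨ξ, v⟩ := q
    by_cases hξ : ξ = 0
    · subst hξ; exact hV v
    · rw [← ofU_eq_ofV_iff.2 (ChartGlue.symm ⟨hξ, rfl⟩)]
      exact hU _ _

/-- The involution exchanging the two charts. -/
def swap (n : ℤ) : LocalSurface n ≃ₜ LocalSurface n where
  toFun := lift (ofV n) (ofU n) fun p q h => (ofU_eq_ofV_iff.2 h.symm).symm
  invFun := lift (ofV n) (ofU n) fun p q h => (ofU_eq_ofV_iff.2 h.symm).symm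
  left_inv x := by induction x using chartCases <;> rfl
  right_inv x := by induction x using chartCases <;> rfl
  continuous_toFun := continuous_lift (continuous_ofV n) (continuous_ofU n)
  continuous_invFun := continuous_lift (continuous_ofV n) (continuous_ofU n)

theorem isOpenEmbedding_ofU (n : ℤ) : Topology.IsOpenEmbedding (ofU n) := by
  refine .of_continuous_injective_isOpenMap (continuous_ofU n) (ofU_injective n) fun W hW => ?_
  refine isOpen_iff.2 ⟨by rwa [Set.preimage_image_eq _ (ofU_injective n)], ?_⟩
  -- In the second chart the image of `W` is its preimage under the transition map, which is
  -- continuous on the open set `ξ ≠ 0`.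
  have h : ofV n ⁻¹' (ofU n '' W) = {q | q.1 ≠ 0} ∩
      (fun q : ℂ × ℂ => (q.1⁻¹, q.1 ^ n * q.2)) ⁻¹' W := by
    ext q
    constructor
    · rintro ⟨p, hp, h⟩
      obtain ⟨h0, rfl⟩ := (ofU_eq_ofV_iff.1 h).symm
      exact ⟨h0, hp⟩
    · rintro ⟨h0, h⟩
      exact ⟨_, h, ofU_eq_ofV_iff.2 (ChartGlue.symm ⟨h0, rfl⟩)⟩
  rw [h]
  refine ContinuousOn.isOpen_inter_preimage ?_ (isOpen_ne_fun continuous_fst continuous_const) hW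
  exact (continuousOn_fst.inv₀ fun q hq => hq).prodMk
    ((continuousOn_fst.zpow₀ n fun q hq => Or.inl hq).mul continuousOn_snd)

theorem isOpenEmbedding_ofV (n : ℤ) : Topology.IsOpenEmbedding (ofV n) :=
  (swap n).isOpenEmbedding.comp (isOpenEmbedding_ofU n)

theorem isOpenQuotientMap_ofCharts (n : ℤ) : IsOpenQuotientMap (ofCharts n) :=
  ⟨(isQuotientMap_ofCharts n).surjective, (isQuotientMap_ofCharts n).continuous,
    isOpenMap_sum.2 ⟨(isOpenEmbedding_ofU n).isOpenMap, (isOpenEmbedding_ofV n).isOpenMap⟩⟩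

/-- Multiplication by a complex number in the fibres of the line bundle. -/
def scale (c : ℂ) : LocalSurface n → LocalSurface n :=
  lift (fun p => ofU n (p.1, c * p.2)) (fun q => ofV n (q.1, c * q.2)) (by
    rintro p q ⟨h0, rfl⟩
    rw [ofU_eq_ofV h0, mul_left_comm])

@[simp]
theorem scale_ofU (c : ℂ) (p : ℂ × ℂ) : scale c (ofU n p) = ofU n (p.1, c * p.2) := rfl

@[simp]
theorem scale_ofV (c : ℂ) (p : ℂ × ℂ) : scale c (ofV n p) = ofV n (p.1, c * p.2) := rfl

theorem scale_one (x : LocalSurface n) : scale 1 x = x := by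
  induction x using chartCases <;> simp

/-- The quotient map from the charts is open, so its product with the identity of `ℂ` is still a
quotient map, and joint continuity can be checked in the charts. -/
theorem continuous_scale : Continuous fun a : ℂ × LocalSurface n => scale a.1 a.2 := by
  refine (IsOpenQuotientMap.id.prodMap
    (isOpenQuotientMap_ofCharts n)).isQuotientMap.continuous_iff.2 ?_
  rw [← (Homeomorph.prodSumDistrib (X := ℂ)).symm.comp_continuous_iff', continuous_sum_dom]
  constructor
  · exact (continuous_ofU n).comp (f := fun a : ℂ × ℂ × ℂ => (a.2.1, a.1 * a.2.2)) (by fun_prop)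
  · exact (continuous_ofV n).comp (f := fun a : ℂ × ℂ × ℂ => (a.2.1, a.1 * a.2.2)) (by fun_prop)

theorem sqrt_one_add_sq_norm_inv {z : ℂ} (hz : z ≠ 0) :
    √(1 + ‖z⁻¹‖ ^ 2) = ‖z‖⁻¹ * √(1 + ‖z‖ ^ 2) := by
  have h := norm_pos_iff.2 hz
  rw [← Real.sqrt_sq (inv_pos.2 h).le, ← Real.sqrt_mul (by positivity), norm_inv]
  congr 1
  field_simp
  ring

/-- The fibrewise norm of a Hermitian metric on the line bundle. -/
noncomputable def fibreNorm : LocalSurface n → ℝ :=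
  lift (fun p => √(1 + ‖p.1‖ ^ 2) ^ n * ‖p.2‖) (fun p => √(1 + ‖p.1‖ ^ 2) ^ n * ‖p.2‖) (by
    rintro p q ⟨h0, rfl⟩
    have h := norm_pos_iff.2 h0
    dsimp only
    rw [sqrt_one_add_sq_norm_inv h0, norm_mul, norm_zpow, mul_zpow, inv_zpow]
    field_simp)

theorem fibreNorm_ofU (p : ℂ × ℂ) :
    fibreNorm (ofU n p) = √(1 + ‖p.1‖ ^ 2) ^ n * ‖p.2‖ := rfl

theorem fibreNorm_ofV (p : ℂ × ℂ) :
    fibreNorm (ofV n p) = √(1 + ‖p.1‖ ^ 2) ^ n * ‖p.2‖ := rfl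

theorem continuous_fibreNorm : Continuous (fibreNorm (n := n)) := by
  have h : Continuous fun p : ℂ × ℂ => √(1 + ‖p.1‖ ^ 2) ^ n * ‖p.2‖ :=
    (Continuous.zpow₀ (by fun_prop) n fun p => Or.inl (by positivity)).mul (by fun_prop)
  exact continuous_lift h h

theorem fibreNorm_scale (c : ℂ) (x : LocalSurface n) :
    fibreNorm (scale c x) = ‖c‖ * fibreNorm x := by
  induction x using chartCases <;>
    simp only [scale_ofU, scale_ofV, fibreNorm_ofU, fibreNorm_ofV, norm_mul] <;> ring

theorem fibreNorm_nonneg (x : LocalSurface n) : 0 ≤ fibreNorm x := by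
  induction x using chartCases <;> simp only [fibreNorm_ofU, fibreNorm_ofV] <;> positivity

theorem ofU_mem_collar {p : ℂ × ℂ} : ofU n p ∈ collar n ↔ p.2 ≠ 0 := by
  obtain ⟨z, u⟩ := p
  simp only [collar, zeroSection, Set.mem_compl_iff, Set.mem_union, Set.mem_range, not_or,
    not_exists]
  refine ⟨fun h hu => h.1 z (by rw [show u = 0 from hu]), fun h => ⟨fun z' hz' => ?_, fun ξ hξ => ?_⟩⟩
  · exact h (congrArg Prod.snd (ofU_injective n hz')).symm
  · obtain ⟨h0, h1⟩ := ofU_eq_ofV_iff.1 hξ.symm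
    have := (congrArg Prod.snd h1).symm
    exact (mul_ne_zero (zpow_ne_zero n h0) h) this

theorem ofV_mem_collar {p : ℂ × ℂ} : ofV n p ∈ collar n ↔ p.2 ≠ 0 := by
  obtain ⟨ξ, v⟩ := p
  simp only [collar, zeroSection, Set.mem_compl_iff, Set.mem_union, Set.mem_range, not_or,
    not_exists]
  refine ⟨fun h hu => h.2 ξ (by rw [show v = 0 from hu]), fun h => ⟨fun z hz => ?_, fun ξ' hξ' => ?_⟩⟩
  · obtain ⟨h0, h1⟩ := (ofU_eq_ofV_iff.1 hz).symm
    have := (congrArg Prod.snd h1).symm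
    exact (mul_ne_zero (zpow_ne_zero n h0) h) this
  · exact h (congrArg Prod.snd (ofV_injective n hξ')).symm

theorem mem_collar_iff {x : LocalSurface n} : x ∈ collar n ↔ fibreNorm x ≠ 0 := by
  induction x using chartCases with
  | hU p =>
    have : √(1 + ‖p.1‖ ^ 2) ^ n ≠ 0 := zpow_ne_zero _ (by positivity)
    simp [ofU_mem_collar, fibreNorm_ofU, this]
  | hV p =>
    have : √(1 + ‖p.1‖ ^ 2) ^ n ≠ 0 := zpow_ne_zero _ (by positivity)
    simp [ofV_mem_collar, fibreNorm_ofV, this]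

end LocalSurface

/-! ### Stereographic charts of the sphere and the bundle projection -/

/-- The stereographic parametrization of the complement of the south pole. -/
noncomputable def northChart (z : ℂ) : TwoSphere :=
  ⟨!₂[2 * z.re / (1 + Complex.normSq z), 2 * z.im / (1 + Complex.normSq z),
      (1 - Complex.normSq z) / (1 + Complex.normSq z)], by
    have h : 1 + Complex.normSq z ≠ 0 := by positivity [Complex.normSq_nonneg z]
    have h' := Complex.normSq_apply z
    simp only [mem_sphere_zero_iff_norm, EuclideanSpace.norm_eq, Fin.sum_univ_three,
      Real.norm_eq_abs, sq_abs, Real.sqrt_eq_one]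
    simp only [Matrix.cons_val]
    field_simp
    rw [h']
    ring⟩

theorem TwoSphere.sum_sq (b : TwoSphere) : b.1 0 ^ 2 + b.1 1 ^ 2 + b.1 2 ^ 2 = 1 := by
  have h := mem_sphere_zero_iff_norm.1 b.2
  rw [EuclideanSpace.norm_eq, Real.sqrt_eq_one, Fin.sum_univ_three] at h
  simpa only [Real.norm_eq_abs, sq_abs] using h

/-- The rotation of the sphere by a half turn around the first axis. -/
noncomputable def halfTurn : TwoSphere ≃ₜ TwoSphere where
  toFun b := ⟨!₂[b.1 0, -b.1 1, -b.1 2], by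
    simpa [EuclideanSpace.norm_eq, Fin.sum_univ_three] using b.sum_sq⟩
  invFun b := ⟨!₂[b.1 0, -b.1 1, -b.1 2], by
    simpa [EuclideanSpace.norm_eq, Fin.sum_univ_three] using b.sum_sq⟩
  left_inv b := by ext i; fin_cases i <;> simp
  right_inv b := by ext i; fin_cases i <;> simp
  continuous_toFun := by
    refine Continuous.subtype_mk ?_ _
    refine (PiLp.continuous_toLp 2 _).comp (continuous_pi fun i => ?_)
    fin_cases i <;> simp <;> fun_prop
  continuous_invFun := by
    refine Continuous.subtype_mk ?_ _
    refine (PiLp.continuous_toLp 2 _).comp (continuous_pi fun i => ?_)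
    fin_cases i <;> simp <;> fun_prop

/-- The stereographic parametrization of the complement of the north pole. -/
noncomputable def southChart (ξ : ℂ) : TwoSphere := halfTurn (northChart ξ)

theorem TwoSphere.eq_southPole_iff {b : TwoSphere} : b = southPole ↔ 1 + b.1 2 = 0 := by
  constructor
  · rintro rfl; simp [southPole]
  · intro h
    have h2 : b.1 2 = -1 := by linarith
    have hs := b.sum_sq
    rw [h2] at hs
    have h0 : b.1 0 = 0 := by nlinarith [sq_nonneg (b.1 0), sq_nonneg (b.1 1)]
    have h1 : b.1 1 = 0 := by nlinarith [sq_nonneg (b.1 0), sq_nonneg (b.1 1)]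
    ext i; fin_cases i <;> simp [southPole, h0, h1, h2]

/-- `northChart` and its inverse, stereographic projection from the south pole. -/
noncomputable def northChartHomeomorph : OpenPartialHomeomorph ℂ TwoSphere where
  toFun := northChart
  invFun b := ⟨b.1 0 / (1 + b.1 2), b.1 1 / (1 + b.1 2)⟩
  source := Set.univ
  target := {southPole}ᶜ
  map_source' z _ := by
    rw [Set.mem_compl_singleton_iff, Ne, TwoSphere.eq_southPole_iff]
    have h : 0 < 1 + Complex.normSq z := by positivity [Complex.normSq_nonneg z]
    simp only [northChart, PiLp.toLp_apply, Matrix.cons_val]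
    field_simp
    norm_num
  map_target' _ _ := Set.mem_univ _
  left_inv' z _ := by
    have h : 0 < 1 + Complex.normSq z := by positivity [Complex.normSq_nonneg z]
    have h2 : 1 + (1 - Complex.normSq z) / (1 + Complex.normSq z)
      = 2 / (1 + Complex.normSq z) := by field_simp; ring
    apply Complex.ext <;> simp only [northChart, PiLp.toLp_apply, Matrix.cons_val, h2] <;> field_simp
  right_inv' b hb := by
    rw [Set.mem_compl_singleton_iff, Ne, TwoSphere.eq_southPole_iff] at hb
    have hs := b.sum_sq
    -- On the sphere `b₀² + b₁² = (1 - b₂)(1 + b₂)`, so the projected point has square norm `(1 -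
    -- b₂)/(1 + b₂)`.
    have h2 : 1 + Complex.normSq ⟨b.1 0 / (1 + b.1 2), b.1 1 / (1 + b.1 2)⟩ = 2 / (1 + b.1 2) := by
      rw [Complex.normSq_mk]
      field_simp
      linear_combination hs
    have h3 : 1 - Complex.normSq ⟨b.1 0 / (1 + b.1 2), b.1 1 / (1 + b.1 2)⟩
        = 2 * b.1 2 / (1 + b.1 2) := by
      rw [eq_sub_of_add_eq' h2]
      field_simp
      ring
    ext i
    fin_cases i <;> simp only [northChart, h2, h3, PiLp.toLp_apply] <;>
      simp <;> field_simp
  open_source := isOpen_univ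
  open_target := isOpen_compl_singleton
  continuousOn_toFun := by
    refine Continuous.continuousOn (Continuous.subtype_mk ?_ _)
    refine (PiLp.continuous_toLp 2 _).comp (continuous_pi fun i => ?_)
    have h : ∀ z : ℂ, 1 + Complex.normSq z ≠ 0 := fun z => by positivity [Complex.normSq_nonneg z]
    fin_cases i
    · exact Continuous.div (by fun_prop) (by fun_prop) h
    · exact Continuous.div (by fun_prop) (by fun_prop) h
    · exact Continuous.div (by fun_prop) (by fun_prop) h
  continuousOn_invFun := by
    have h : ∀ b ∈ ({southPole}ᶜ : Set TwoSphere), 1 + b.1 2 ≠ 0 := fun b hb h0 =>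
      hb (TwoSphere.eq_southPole_iff.2 h0)
    refine Complex.equivRealProdCLM.symm.continuous.comp_continuousOn
      (ContinuousOn.prodMk (f := fun b : TwoSphere => b.1 0 / (1 + b.1 2))
        (g := fun b : TwoSphere => b.1 1 / (1 + b.1 2)) ?_ ?_)
    · exact ContinuousOn.div (by fun_prop) (by fun_prop) h
    · exact ContinuousOn.div (by fun_prop) (by fun_prop) h

theorem isOpenEmbedding_northChart : Topology.IsOpenEmbedding northChart :=
  northChartHomeomorph.isOpenEmbedding rfl

theorem range_northChart : Set.range northChart = {southPole}ᶜ := by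
  rw [← Set.image_univ]
  exact northChartHomeomorph.image_source_eq_target

theorem isOpenEmbedding_southChart : Topology.IsOpenEmbedding southChart :=
  halfTurn.isOpenEmbedding.comp isOpenEmbedding_northChart

theorem range_southChart : Set.range southChart = {northPole}ᶜ := by
  have h : halfTurn southPole = northPole := by
    ext i; fin_cases i <;> simp [halfTurn, southPole, northPole]
  rw [show southChart = halfTurn ∘ northChart from rfl, Set.range_comp, range_northChart,
    Set.image_compl_eq halfTurn.bijective, Set.image_singleton, h]

/-- Under stereographic projection, inversion `z ↦ z⁻¹` is the half turn around the first axis. -/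
theorem northChart_eq_southChart {z : ℂ} (hz : z ≠ 0) : northChart z = southChart z⁻¹ := by
  have h : 0 < Complex.normSq z := Complex.normSq_pos.2 hz
  ext i
  fin_cases i <;> simp [northChart, southChart, halfTurn] <;> field_simp <;> ring

namespace LocalSurface

variable {n : ℤ}

/-- The bundle projection to the base, identified with the two-sphere. -/
noncomputable def toSphere : LocalSurface n → TwoSphere :=
  lift (fun p => northChart p.1) (fun q => southChart q.1) (by
    rintro p q ⟨h0, rfl⟩
    exact northChart_eq_southChart h0)

theorem continuous_toSphere : Continuous (toSphere (n := n)) :=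
  continuous_lift (isOpenEmbedding_northChart.continuous.comp continuous_fst)
    (isOpenEmbedding_southChart.continuous.comp continuous_fst)

@[simp]
theorem toSphere_ofU (p : ℂ × ℂ) : toSphere (ofU n p) = northChart p.1 := rfl

@[simp]
theorem toSphere_ofV (p : ℂ × ℂ) : toSphere (ofV n p) = southChart p.1 := rfl

/-- The points outside the first chart have `ξ = 0` and lie over the south pole. Hence the chart is
the full preimage of its base, as a local trivialization requires. -/
theorem toSphere_mem_range_northChart {x : LocalSurface n} :
    toSphere x ∈ Set.range northChart ↔ x ∈ Set.range (ofU n) := by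
  refine ⟨fun h => ?_, ?_⟩
  · induction x using chartCases' with
    | hU z u => exact ⟨_, rfl⟩
    | hV v =>
      rw [range_northChart] at h
      refine absurd ?_ h
      ext i; fin_cases i <;> simp [northChart, southChart, halfTurn, southPole]
  · rintro ⟨p, rfl⟩; exact ⟨p.1, rfl⟩

theorem toSphere_swap (x : LocalSurface n) : toSphere (swap n x) = halfTurn (toSphere x) := by
  have h : ∀ b, halfTurn (halfTurn b) = b := halfTurn.left_inv
  induction x using chartCases with
  | hU p => rfl
  | hV p => exact (h _).symm

theorem toSphere_mem_range_southChart {x : LocalSurface n} :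
    toSphere x ∈ Set.range southChart ↔ x ∈ Set.range (ofV n) := by
  have h := toSphere_mem_range_northChart (x := (swap n).symm x)
  have hx : toSphere x = halfTurn (toSphere ((swap n).symm x)) := by
    rw [← toSphere_swap, Homeomorph.apply_symm_apply]
  rw [hx, show southChart = halfTurn ∘ northChart from rfl, Set.range_comp,
    halfTurn.injective.mem_set_image, h, show ofV n = swap n ∘ ofU n from rfl, Set.range_comp]
  exact ⟨fun h => ⟨_, h, (swap n).apply_symm_apply x⟩,
    fun ⟨y, hy, h⟩ => by rwa [← h, Homeomorph.symm_apply_apply]⟩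

end LocalSurface

/-! ### Local trivializations from open embeddings -/

namespace Bundle.Trivialization

variable {A B F Z : Type*} [TopologicalSpace A] [TopologicalSpace B] [TopologicalSpace F]
  [TopologicalSpace Z] [Nonempty A] [Nonempty F] {proj : Z → B} {Φ : A × F → Z} {σ : A → B}

/-- A local trivialization over the range of an open embedding `σ`, from a parametrization `Φ` of
the part of the total space that lies over it. -/
noncomputable def ofIsOpenEmbedding (hΦ : Topology.IsOpenEmbedding Φ)
    (hσ : Topology.IsOpenEmbedding σ) (hproj : ∀ a f, proj (Φ (a, f)) = σ a)
    (hrange : Set.range Φ = proj ⁻¹' Set.range σ) : Trivialization F proj where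
  toOpenPartialHomeomorph := (hΦ.toOpenPartialHomeomorph Φ).symm.trans
    ((hσ.prodMap Topology.IsOpenEmbedding.id).toOpenPartialHomeomorph (Prod.map σ id))
  baseSet := Set.range σ
  open_baseSet := hσ.isOpen_range
  source_eq := by simp [hrange]
  target_eq := by simp [Set.range_prodMap, Set.prod_univ]
  proj_toFun := by
    intro x hx
    obtain ⟨⟨a, f⟩, rfl⟩ : x ∈ Set.range Φ := by simpa using hx
    have h := (hΦ.toOpenPartialHomeomorph Φ).left_inv (x := (a, f)) (by simp)
    rw [Topology.IsOpenEmbedding.toOpenPartialHomeomorph_apply] at h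
    simp [h, hproj]

variable (hΦ : Topology.IsOpenEmbedding Φ) (hσ : Topology.IsOpenEmbedding σ)
  (hproj : ∀ a f, proj (Φ (a, f)) = σ a) (hrange : Set.range Φ = proj ⁻¹' Set.range σ)

theorem ofIsOpenEmbedding_apply (a : A) (f : F) :
    ofIsOpenEmbedding hΦ hσ hproj hrange (Φ (a, f)) = (σ a, f) := by
  have h := (hΦ.toOpenPartialHomeomorph Φ).left_inv (x := (a, f)) (by simp)
  rw [Topology.IsOpenEmbedding.toOpenPartialHomeomorph_apply] at h
  change Prod.map σ id ((hΦ.toOpenPartialHomeomorph Φ).symm (Φ (a, f))) = _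
  rw [h]
  rfl

theorem ofIsOpenEmbedding_coordChange (e : Trivialization F proj) (a : A) (f : F) :
    (ofIsOpenEmbedding hΦ hσ hproj hrange).coordChange e (σ a) f = (e (Φ (a, f))).2 := by
  have h := coordChange_apply_snd (ofIsOpenEmbedding hΦ hσ hproj hrange) e (p := Φ (a, f))
    (by rw [hproj]; exact ⟨a, rfl⟩)
  rwa [ofIsOpenEmbedding_apply, hproj] at h

end Bundle.Trivialization

/-! ### The unit circle bundle and its degree -/

/-- The vectors of norm one in the line bundle. -/
def circleBundle (n : ℤ) : Set (LocalSurface n) := {x | LocalSurface.fibreNorm x = 1}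

namespace LocalSurface

variable {n : ℤ}

/-- The collar retracts onto the circle bundle by normalizing vectors. -/
noncomputable def collarHomotopyEquiv (n : ℤ) : collar n ≃ₕ circleBundle n where
  toFun := ⟨fun x => ⟨scale ((fibreNorm x.1)⁻¹ : ℝ) x.1, by
      have h := mem_collar_iff.1 x.2
      simp only [circleBundle, Set.mem_ofPred_eq, fibreNorm_scale, Complex.norm_real, norm_inv]
      rw [Real.norm_of_nonneg (fibreNorm_nonneg _), inv_mul_cancel₀ h]⟩, by
    refine Continuous.subtype_mk ?_ _
    refine continuous_scale.comp (f := fun x : collar n =>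
      ((((fibreNorm x.1)⁻¹ : ℝ) : ℂ), x.1)) ?_
    refine Continuous.prodMk (Complex.continuous_ofReal.comp ?_) continuous_subtype_val
    exact (continuous_fibreNorm.comp continuous_subtype_val).inv₀ fun x => mem_collar_iff.1 x.2⟩
  invFun := ⟨fun x => ⟨x.1, mem_collar_iff.2 (by rw [show fibreNorm x.1 = 1 from x.2]; simp)⟩,
    by fun_prop⟩
  left_inv := ⟨{
    toFun := fun a => ⟨scale (((1 - (a.1 : ℝ)) * (fibreNorm a.2.1)⁻¹ + a.1 : ℝ)) a.2.1, by
      have h := mem_collar_iff.1 a.2.2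
      rw [mem_collar_iff, fibreNorm_scale]
      refine mul_ne_zero (norm_ne_zero_iff.2 (Complex.ofReal_ne_zero.2 ?_)) h
      have h1 := inv_pos.2 ((fibreNorm_nonneg a.2.1).lt_of_ne' h)
      have h2 := a.1.2.1
      have h3 := a.1.2.2
      rcases h2.eq_or_lt with h | h
      · rw [← h]; simpa using h1.ne'
      · have := mul_nonneg (sub_nonneg.2 h3) h1.le
        positivity⟩
    continuous_toFun := by
      refine Continuous.subtype_mk ?_ _
      refine continuous_scale.comp (f := fun a : unitInterval × collar n =>
        ((((1 - (a.1 : ℝ)) * (fibreNorm a.2.1)⁻¹ + a.1 : ℝ) : ℂ), a.2.1)) ?_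
      have : Continuous fun a : unitInterval × collar n => (fibreNorm a.2.1)⁻¹ :=
        (continuous_fibreNorm.comp (by fun_prop)).inv₀ fun a => mem_collar_iff.1 a.2.2
      fun_prop
    map_zero_left := fun x => by ext; simp
    map_one_left := fun x => by ext; simp [scale_one] }⟩
  right_inv := by
    convert ContinuousMap.Homotopic.refl _
    ext x
    have h : fibreNorm x.1 = 1 := x.2
    simp [h, scale_one]

theorem sqrt_zpow_pos (z : ℂ) (n : ℤ) : 0 < √(1 + ‖z‖ ^ 2) ^ n := by positivity

theorem continuous_sqrt_zpow (n : ℤ) : Continuous fun z : ℂ => √(1 + ‖z‖ ^ 2) ^ n :=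
  Continuous.zpow₀ (by fun_prop) n fun p => Or.inl (by positivity)

/-- The part of the circle bundle in a chart, parametrized by the base coordinate and the
phase. -/
noncomputable def circleChartHomeomorph {κ : ℂ × ℂ → LocalSurface n}
    (hN : ∀ p, fibreNorm (κ p) = √(1 + ‖p.1‖ ^ 2) ^ n * ‖p.2‖) :
    ℂ × Circle ≃ₜ κ ⁻¹' circleBundle n where
  toFun a := ⟨(a.1, ((√(1 + ‖a.1‖ ^ 2) ^ n)⁻¹ : ℝ) * a.2), by
    have := sqrt_zpow_pos a.1 n
    simp only [circleBundle, Set.mem_preimage, Set.mem_ofPred_eq, hN, norm_mul, Complex.norm_real,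
      Circle.norm_coe, mul_one, norm_inv]
    rw [Real.norm_of_nonneg this.le, mul_inv_cancel₀ this.ne']⟩
  invFun p := (p.1.1, ⟨(√(1 + ‖p.1.1‖ ^ 2) ^ n : ℝ) * p.1.2, by
    have h : fibreNorm (κ p.1) = 1 := p.2
    rw [hN] at h
    refine mem_sphere_zero_iff_norm.2 ?_
    rwa [norm_mul, Complex.norm_real, Real.norm_of_nonneg (sqrt_zpow_pos _ _).le]⟩)
  left_inv a := by
    refine Prod.ext rfl (Circle.ext ?_)
    have := (sqrt_zpow_pos a.1 n).ne'
    change ((√(1 + ‖a.1‖ ^ 2) ^ n : ℝ) : ℂ) * (((√(1 + ‖a.1‖ ^ 2) ^ n)⁻¹ : ℝ) * a.2) = a.2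
    rw [← mul_assoc, ← Complex.ofReal_mul, mul_inv_cancel₀ this, Complex.ofReal_one, one_mul]
  right_inv p := by
    refine Subtype.ext (Prod.ext rfl ?_)
    have := (sqrt_zpow_pos p.1.1 n).ne'
    simp only
    rw [← mul_assoc, ← Complex.ofReal_mul, inv_mul_cancel₀ this, Complex.ofReal_one, one_mul]
  continuous_toFun := by
    have : Continuous fun a : ℂ × Circle => (√(1 + ‖a.1‖ ^ 2) ^ n)⁻¹ :=
      ((continuous_sqrt_zpow n).comp continuous_fst).inv₀ fun a => (sqrt_zpow_pos a.1 n).ne'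
    refine Continuous.subtype_mk ?_ _
    fun_prop
  continuous_invFun := by
    have : Continuous fun p : κ ⁻¹' circleBundle n => √(1 + ‖p.1.1‖ ^ 2) ^ n :=
      (continuous_sqrt_zpow n).comp (by fun_prop)
    refine Continuous.prodMk (by fun_prop) (Continuous.subtype_mk ?_ _)
    fun_prop

/-- A chart of the circle bundle. -/
noncomputable def circleChart {κ : ℂ × ℂ → LocalSurface n}
    (hN : ∀ p, fibreNorm (κ p) = √(1 + ‖p.1‖ ^ 2) ^ n * ‖p.2‖) : ℂ × Circle → circleBundle n :=
  (circleBundle n).restrictPreimage κ ∘ circleChartHomeomorph hN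

theorem coe_circleChart {κ : ℂ × ℂ → LocalSurface n}
    (hN : ∀ p, fibreNorm (κ p) = √(1 + ‖p.1‖ ^ 2) ^ n * ‖p.2‖) (z : ℂ) (s : Circle) :
    (circleChart hN (z, s) : LocalSurface n) = κ (z, ((√(1 + ‖z‖ ^ 2) ^ n)⁻¹ : ℝ) * s) := rfl

theorem isOpenEmbedding_circleChart {κ : ℂ × ℂ → LocalSurface n}
    (hN : ∀ p, fibreNorm (κ p) = √(1 + ‖p.1‖ ^ 2) ^ n * ‖p.2‖)
    (hκ : Topology.IsOpenEmbedding κ) : Topology.IsOpenEmbedding (circleChart hN) :=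
  (hκ.restrictPreimage _).comp (circleChartHomeomorph hN).isOpenEmbedding

theorem range_circleChart {κ : ℂ × ℂ → LocalSurface n}
    (hN : ∀ p, fibreNorm (κ p) = √(1 + ‖p.1‖ ^ 2) ^ n * ‖p.2‖) :
    Set.range (circleChart hN) = Subtype.val ⁻¹' Set.range κ := by
  rw [circleChart, (circleChartHomeomorph hN).surjective.range_comp, Set.range_restrictPreimage]

/-- Write `zⁿ = |z|ⁿ (z/|z|)ⁿ`. The factor `|z|ⁿ` is absorbed by the different normalizations in the
two charts, so only the phase acts on the fibre. -/
theorem circleChart_ofU_eq_circleChart_ofV {z : ℂ} (hz : z ≠ 0) (s : Circle) :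
    circleChart fibreNorm_ofU (z, s)
      = circleChart (n := n) fibreNorm_ofV (z⁻¹, Circle.exp z.arg ^ n * s) := by
  refine Subtype.ext ?_
  rw [coe_circleChart, coe_circleChart, ofU_eq_ofV hz, sqrt_one_add_sq_norm_inv hz]
  congr 2
  have hz' : z ^ n = (‖z‖ : ℂ) ^ n * Complex.exp (z.arg * Complex.I) ^ n := by
    rw [← mul_zpow, Complex.norm_mul_exp_arg_mul_I]
  simp only [mul_zpow, Circle.coe_mul, Circle.coe_zpow, Circle.coe_exp, inv_zpow, mul_inv, inv_inv,
    hz']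
  push_cast
  ring

/-- The bundle projection of the circle bundle. -/
noncomputable def circleProj (n : ℤ) (x : circleBundle n) : TwoSphere := toSphere x.1

/-- The horizontal coordinates of the point on the sphere are a positive multiple of `z`. This
expresses the gluing rotation as a function of the base point. -/
theorem arg_northChart (z : ℂ) :
    Complex.arg ⟨(northChart z).1 0, (northChart z).1 1⟩ = z.arg := by
  have h : 0 < 2 / (1 + Complex.normSq z) := by positivity [Complex.normSq_nonneg z]
  rw [← Complex.arg_real_mul z h]
  congr 1
  apply Complex.ext <;> simp only [northChart, Complex.re_ofReal_mul, Complex.im_ofReal_mul] <;>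
    simp <;> ring

theorem isCircleBundleOfDegree_circleProj (n : ℤ) : IsCircleBundleOfDegree (circleProj n) n := by
  have hU : Set.range (circleChart (n := n) fibreNorm_ofU)
      = circleProj n ⁻¹' Set.range northChart := by
    ext x
    rw [range_circleChart]
    exact toSphere_mem_range_northChart.symm
  have hV : Set.range (circleChart (n := n) fibreNorm_ofV)
      = circleProj n ⁻¹' Set.range southChart := by
    ext x
    rw [range_circleChart]
    exact toSphere_mem_range_southChart.symm
  have hU' : ∀ z s, circleProj n (circleChart fibreNorm_ofU (z, s)) = northChart z := fun _ _ => rfl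
  have hV' : ∀ z s, circleProj n (circleChart fibreNorm_ofV (z, s)) = southChart z := fun _ _ => rfl
  refine ⟨.ofIsOpenEmbedding (isOpenEmbedding_circleChart _ (isOpenEmbedding_ofU n))
      isOpenEmbedding_northChart hU' hU,
    .ofIsOpenEmbedding (isOpenEmbedding_circleChart _ (isOpenEmbedding_ofV n))
      isOpenEmbedding_southChart hV' hV, range_northChart, range_southChart,
    -- The rotation is the `n`-th power of the phase of the longitude; on the equator, angle `t`
    -- gives `exp(i n t)`, so `t ↦ n t` is the required lift.
    fun b => Circle.exp (Complex.arg ⟨b.1 0, b.1 1⟩) ^ n, fun b hS hN s => ?_,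
    fun t => n * t, by fun_prop, fun t => ?_, fun t => by ring⟩
  · obtain ⟨z, rfl⟩ : b ∈ Set.range northChart := by rwa [range_northChart]
    have hz : z ≠ 0 := by
      rintro rfl
      refine hN ?_
      ext i; fin_cases i <;> simp [northChart, northPole]
    rw [Bundle.Trivialization.ofIsOpenEmbedding_coordChange,
      circleChart_ofU_eq_circleChart_ofV hz, Bundle.Trivialization.ofIsOpenEmbedding_apply]
    dsimp only
    rw [arg_northChart]
  · have : (⟨(equator (Circle.exp t)).1 0, (equator (Circle.exp t)).1 1⟩ : ℂ) = Circle.exp t :=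
      Complex.ext rfl rfl
    dsimp only
    rw [this, Circle.exp_arg, ← Circle.exp_zsmul, zsmul_eq_mul]

end LocalSurface

/-! ### Fundamental groups from simply connected coverings -/

theorem IsQuotientCoveringMap.nonempty_fundamentalGroup_mulEquiv {E X G H : Type*}
    [TopologicalSpace E] [TopologicalSpace X] [Group G] [MulAction G E] [Group H]
    [SimplyConnectedSpace E] {p : E → X} (hp : IsQuotientCoveringMap p G) (e : G ≃* H) (x : X) :
    Nonempty (FundamentalGroup X x ≃* H) := by
  obtain ⟨y, hy⟩ := hp.surjective x
  -- The monodromy isomorphism lands in the opposite group; inversion brings it back to `G`.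
  exact ⟨((hp.fundamentalGroupEquiv ⟨y, hy⟩).trans (MulEquiv.inv' G).symm).trans e⟩

/-- The action on a product through its second factor. -/
@[reducible]
def AddAction.prodRight (B G E : Type*) [AddMonoid G] [AddAction G E] : AddAction G (B × E) where
  vadd g a := (a.1, g +ᵥ a.2)
  zero_vadd a := Prod.ext rfl (zero_vadd G a.2)
  add_vadd g h a := Prod.ext rfl (add_vadd g h a.2)

theorem IsAddQuotientCoveringMap.prodMap_id {B E X G : Type*} [TopologicalSpace B]
    [TopologicalSpace E] [TopologicalSpace X] [AddGroup G] [AddAction G E] {f : E → X}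
    (hf : IsAddQuotientCoveringMap f G) :
    letI := AddAction.prodRight B G E
    IsAddQuotientCoveringMap (Prod.map id f : B × E → B × X) G :=
  letI := AddAction.prodRight B G E
  { (IsOpenQuotientMap.id.prodMap hf.isOpenQuotientMap).isQuotientMap with
    continuous_const_vadd := fun g =>
      have := hf.continuous_const_vadd g
      continuous_fst.prodMk (this.comp continuous_snd)
    apply_eq_iff_mem_orbit := by
      rintro ⟨b₁, e₁⟩ ⟨b₂, e₂⟩
      rw [Prod.map_apply, Prod.map_apply, Prod.mk.injEq, hf.apply_eq_iff_mem_orbit]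
      constructor
      · rintro ⟨rfl, g, rfl⟩
        exact ⟨g, rfl⟩
      · rintro ⟨g, hg⟩
        exact ⟨(congrArg Prod.fst hg).symm, g, congrArg Prod.snd hg⟩
    disjoint := fun e => by
      obtain ⟨U, hU, h⟩ := hf.disjoint e.2
      refine ⟨Prod.snd ⁻¹' U, continuous_snd.continuousAt hU, fun g hg => h g ?_⟩
      obtain ⟨_, ⟨a, ha, rfl⟩, h'⟩ := hg
      exact ⟨_, ⟨a.2, ha, rfl⟩, h'⟩ }

instance {X Y : Type*} [TopologicalSpace X] [TopologicalSpace Y] [SimplyConnectedSpace X]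
    [ContractibleSpace Y] : SimplyConnectedSpace (X × Y) := by
  obtain ⟨e⟩ := ContractibleSpace.hequiv Y Unit
  exact (((ContinuousMap.HomotopyEquiv.refl X).prodCongr e).trans
    (Homeomorph.prodPUnit X).toHomotopyEquiv).simplyConnectedSpace

/-! ### The fundamental group of the collar for `n = 0` -/

namespace LocalSurface

theorem _root_.ChartGlue.snd_eq {p q : ℂ × ℂ} (h : ChartGlue 0 p q) : p.2 = q.2 := by
  obtain ⟨-, rfl⟩ := h
  simp

/-- The surface `Z_0` is a product. -/
noncomputable def zeroHomeomorph : LocalSurface 0 ≃ₜ TwoSphere × ℂ :=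
  let f : LocalSurface 0 → TwoSphere × ℂ := fun x =>
    (toSphere x, lift Prod.snd Prod.snd (fun _ _ => ChartGlue.snd_eq) x)
  have hU : Topology.IsOpenEmbedding (f ∘ ofU 0) :=
    isOpenEmbedding_northChart.prodMap Topology.IsOpenEmbedding.id
  have hV : Topology.IsOpenEmbedding (f ∘ ofV 0) :=
    isOpenEmbedding_southChart.prodMap Topology.IsOpenEmbedding.id
  have hopen : IsOpenMap f := fun W hW => by
    have h : f '' W = (f ∘ ofU 0) '' (ofU 0 ⁻¹' W) ∪ (f ∘ ofV 0) '' (ofV 0 ⁻¹' W) := by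
      ext y
      constructor
      · rintro ⟨x, hx, rfl⟩
        induction x using chartCases with
        | hU p => exact Or.inl ⟨p, hx, rfl⟩
        | hV p => exact Or.inr ⟨p, hx, rfl⟩
      · rintro (⟨p, hp, rfl⟩ | ⟨p, hp, rfl⟩)
        exacts [⟨_, hp, rfl⟩, ⟨_, hp, rfl⟩]
    rw [h]
    exact (hU.isOpenMap _ (isOpen_iff.1 hW).1).union (hV.isOpenMap _ (isOpen_iff.1 hW).2)
  -- Two points over the same base point lie in a common chart, where `f` is injective.
  have hinj : Function.Injective f := fun x y h => by
    have hxy : toSphere x = toSphere y := congrArg Prod.fst h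
    by_cases hx : x ∈ Set.range (ofU 0)
    · have hy := hx
      rw [← toSphere_mem_range_northChart, hxy, toSphere_mem_range_northChart] at hy
      obtain ⟨p, rfl⟩ := hx
      obtain ⟨q, rfl⟩ := hy
      exact congrArg _ (hU.injective h)
    · have hy := hx
      rw [← toSphere_mem_range_northChart, hxy, toSphere_mem_range_northChart] at hy
      induction x using chartCases with
      | hU p => exact absurd ⟨p, rfl⟩ hx
      | hV p =>
        induction y using chartCases with
        | hU q => exact absurd ⟨q, rfl⟩ hy
        | hV q => exact congrArg _ (hV.injective h)
  have hsurj : Function.Surjective f := fun ⟨b, w⟩ => by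
    by_cases hb : b = southPole
    · have : b ∈ Set.range southChart := by
        rw [range_southChart, Set.mem_compl_singleton_iff, hb]
        intro h
        have : (-1 : ℝ) = 1 := congrArg (fun b : TwoSphere => b.1 2) h
        norm_num at this
      obtain ⟨ξ, rfl⟩ := this
      exact ⟨ofV 0 (ξ, w), rfl⟩
    · obtain ⟨z, rfl⟩ : b ∈ Set.range northChart := by rwa [range_northChart]
      exact ⟨ofU 0 (z, w), rfl⟩
  (Equiv.ofBijective f ⟨hinj, hsurj⟩).toHomeomorphOfContinuousOpen
    (continuous_toSphere.prodMk 
      (continuous_lift (h := fun _ _ => ChartGlue.snd_eq) continuous_snd continuous_snd)) hopen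

theorem zeroHomeomorph_snd_ne_zero_iff {x : LocalSurface 0} :
    (zeroHomeomorph x).2 ≠ 0 ↔ x ∈ collar 0 := by
  induction x using chartCases with
  | hU p => exact (ofU_mem_collar (p := p)).symm
  | hV p => exact (ofV_mem_collar (p := p)).symm

/-- The collar of the zero section in `Z_0` is a product. -/
noncomputable def collarZeroHomeomorph : TwoSphere × {u : ℂ // u ≠ 0} ≃ₜ collar 0 where
  toFun a := ⟨zeroHomeomorph.symm (a.1, a.2), by
    rw [← zeroHomeomorph_snd_ne_zero_iff, Homeomorph.apply_symm_apply]
    exact a.2.2⟩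
  invFun x := ((zeroHomeomorph x.1).1, ⟨(zeroHomeomorph x.1).2,
    zeroHomeomorph_snd_ne_zero_iff.2 x.2⟩)
  left_inv a := by simp
  right_inv x := by simp
  continuous_toFun := by fun_prop
  continuous_invFun := by fun_prop

theorem nonempty_fundamentalGroup_collar_zero (x : collar 0) :
    Nonempty (FundamentalGroup (collar 0) x ≃* Multiplicative (ZMod 0)) := by
  let := AddAction.prodRight TwoSphere (AddSubgroup.zmultiples (2 * Real.pi * Complex.I)) ℂ
  have hp := (Complex.isAddQuotientCoveringMap_exp.prodMap_id (B := TwoSphere)).homeomorph_comp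
    collarZeroHomeomorph
  -- The deck group is infinite, so `Nat.card` takes its default value 0, which matches `ZMod 0 =
  -- ℤ`.
  have h0 : Nat.card (AddSubgroup.zmultiples (2 * Real.pi * Complex.I)) = 0 := by
    rw [Nat.card_zmultiples, addOrderOf_eq_zero_iff']
    intro m hm
    simp [hm.ne', Real.pi_ne_zero]
  have e := (zmodAddCyclicAddEquiv
    (inferInstance : IsAddCyclic (AddSubgroup.zmultiples (2 * Real.pi * Complex.I)))).symm
  rw [h0] at e
  exact hp.toMultiplicative.nonempty_fundamentalGroup_mulEquiv e.toMultiplicative x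

/-! ### The covering of the collar by the punctured plane for `n ≠ 0` -/

variable {n : ℤ}

open Classical in
/-- The map that presents the collar as a quotient of the punctured plane: the pair `(a, b)` goes
to the point `(b / a, aⁿ)` in the first chart, which is `(a / b, bⁿ)` in the second chart. -/
noncomputable def powMap (n : ℤ) (p : ℂ × ℂ) : LocalSurface n :=
  if p.1 = 0 then ofV n (p.1 / p.2, p.2 ^ n) else ofU n (p.2 / p.1, p.1 ^ n)

theorem powMap_of_fst_ne_zero {p : ℂ × ℂ} (h : p.1 ≠ 0) :
    powMap n p = ofU n (p.2 / p.1, p.1 ^ n) := if_neg h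

/-- The two chart expressions agree on the overlap because `(b/a)ⁿ aⁿ = bⁿ`. -/
theorem powMap_of_snd_ne_zero {p : ℂ × ℂ} (h : p.2 ≠ 0) :
    powMap n p = ofV n (p.1 / p.2, p.2 ^ n) := by
  by_cases h1 : p.1 = 0
  · exact if_pos h1
  · rw [powMap_of_fst_ne_zero h1, ofU_eq_ofV (div_ne_zero h h1), inv_div, ← mul_zpow,
      div_mul_cancel₀ _ h1]

theorem fst_ne_zero_or_snd_ne_zero {p : ℂ × ℂ} (h : p ≠ 0) : p.1 ≠ 0 ∨ p.2 ≠ 0 := by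
  contrapose! h
  exact Prod.ext h.1 h.2

theorem powMap_mem_collar {p : ℂ × ℂ} (h : p ≠ 0) : powMap n p ∈ collar n := by
  rcases fst_ne_zero_or_snd_ne_zero h with h | h
  · rw [powMap_of_fst_ne_zero h, ofU_mem_collar]
    exact zpow_ne_zero n h
  · rw [powMap_of_snd_ne_zero h, ofV_mem_collar]
    exact zpow_ne_zero n h

theorem continuousAt_powMap {p : ℂ × ℂ} (h : p ≠ 0) : ContinuousAt (powMap n) p := by
  rcases fst_ne_zero_or_snd_ne_zero h with h | h
  · have h1 : ContinuousAt (fun p : ℂ × ℂ => (p.2 / p.1, p.1 ^ n)) p :=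
      (continuousAt_snd.div continuousAt_fst h).prodMk (continuousAt_fst.zpow₀ n (Or.inl h))
    refine ((continuous_ofU n).continuousAt.comp h1).congr ?_
    filter_upwards [(isOpen_ne_fun continuous_fst continuous_const).mem_nhds h] with q hq
    exact (powMap_of_fst_ne_zero hq).symm
  · have h1 : ContinuousAt (fun p : ℂ × ℂ => (p.1 / p.2, p.2 ^ n)) p :=
      (continuousAt_fst.div continuousAt_snd h).prodMk (continuousAt_snd.zpow₀ n (Or.inl h))
    refine ((continuous_ofV n).continuousAt.comp h1).congr ?_
    filter_upwards [(isOpen_ne_fun continuous_snd continuous_const).mem_nhds h] with q hq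
    exact (powMap_of_snd_ne_zero hq).symm

/-- The restriction of `powMap` to a map from the punctured plane to the collar. -/
noncomputable def collarPowMap (n : ℤ) (p : {p : ℂ × ℂ // p ≠ 0}) : collar n :=
  ⟨powMap n p, powMap_mem_collar p.2⟩

theorem continuous_collarPowMap : Continuous (collarPowMap n) :=
  Continuous.subtype_mk (continuous_iff_continuousAt.2 fun p =>
    (continuousAt_powMap p.2).comp continuousAt_subtype_val) _

theorem zpow_surjective (hn : n ≠ 0) : Function.Surjective fun x : ℂ => x ^ n := by
  intro y
  obtain ⟨m, rfl | rfl⟩ := n.eq_nat_or_neg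
  · exact ⟨y ^ ((m : ℂ)⁻¹), by simpa using Complex.cpow_nat_inv_pow y (by simpa using hn)⟩
  · exact ⟨(y⁻¹) ^ ((m : ℂ)⁻¹), by
      have := Complex.cpow_nat_inv_pow y⁻¹ (n := m) (by simpa using hn)
      simp [this]⟩

theorem isOpenQuotientMap_zpow_units (hn : n ≠ 0) : IsOpenQuotientMap fun x : ℂˣ => x ^ n :=
  (isQuotientCoveringMap_zpow n (by exact_mod_cast hn) (zpow_surjective hn)).isOpenQuotientMap

/-- Read through `θ`, which is `(z, a) ↦ (a, z a)` for the first chart and `(ξ, b) ↦ (ξ b, b)` for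
the second, the map `powMap` becomes `id × (x ↦ xⁿ)` on `ℂ × ℂˣ`. That is an open quotient map, so
openness descends to the part of the chart off the zero section. -/
theorem isOpen_preimage_of_isOpen_powMap_preimage (hn : n ≠ 0) {κ : ℂ × ℂ → LocalSurface n}
    (hκ : ∀ p, κ p ∈ collar n ↔ p.2 ≠ 0) {θ : ℂ × ℂˣ → {p : ℂ × ℂ // p ≠ 0}} (hθ : Continuous θ)
    (h : ∀ a, κ (a.1, a.2 ^ n) = powMap n (θ a)) {W : Set (collar n)}
    (hW : IsOpen (collarPowMap n ⁻¹' W)) : IsOpen (κ ⁻¹' (Subtype.val '' W)) := by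
  have hm : IsOpenMap (Prod.map id Units.val : ℂ × ℂˣ → ℂ × ℂ) :=
    IsOpenMap.id.prodMap Units.isOpenEmbedding_val.isOpenMap
  have hrange : κ ⁻¹' (Subtype.val '' W) = (Prod.map id Units.val : ℂ × ℂˣ → ℂ × ℂ) ''
      ((Prod.map id Units.val : ℂ × ℂˣ → ℂ × ℂ) ⁻¹' (κ ⁻¹' (Subtype.val '' W))) := by
    rw [Set.image_preimage_eq_inter_range, eq_comm, Set.inter_eq_left]
    rintro p ⟨x, hx, hp⟩
    have h2 : p.2 ≠ 0 := (hκ p).1 (hp ▸ x.2)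
    exact ⟨(p.1, Units.mk0 p.2 h2), rfl⟩
  rw [hrange]
  refine hm _ ?_
  rw [← (IsOpenQuotientMap.id.prodMap (isOpenQuotientMap_zpow_units hn)).isQuotientMap.isOpen_preimage]
  convert hW.preimage hθ using 1
  ext a
  have hκθ : κ (Prod.map id Units.val (Prod.map id (fun x : ℂˣ => x ^ n) a)) = powMap n (θ a) := by
    rw [← h a]
    exact congrArg κ (Prod.ext rfl (Units.val_zpow_eq_zpow_val _ _))
  refine ⟨fun ⟨x, hx, h'⟩ => ?_, fun h' => ⟨_, h', hκθ.symm⟩⟩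
  obtain rfl : x = collarPowMap n (θ a) := Subtype.ext (h'.trans hκθ)
  exact hx

theorem surjective_collarPowMap (hn : n ≠ 0) : Function.Surjective (collarPowMap n) := by
  rintro ⟨x, hx⟩
  induction x using chartCases with
  | hU p =>
    obtain ⟨z, u⟩ := p
    obtain ⟨a, rfl⟩ := zpow_surjective hn u
    have ha : a ≠ 0 := by
      rintro rfl
      exact ofU_mem_collar.1 hx (zero_zpow n hn)
    refine ⟨⟨(a, z * a), fun h => ha (congrArg Prod.fst h)⟩, Subtype.ext ?_⟩
    change powMap n (a, z * a) = _
    rw [powMap_of_fst_ne_zero ha, mul_div_cancel_right₀ _ ha]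
  | hV p =>
    obtain ⟨z, u⟩ := p
    obtain ⟨a, rfl⟩ := zpow_surjective hn u
    have ha : a ≠ 0 := by
      rintro rfl
      exact ofV_mem_collar.1 hx (zero_zpow n hn)
    refine ⟨⟨(z * a, a), fun h => ha (congrArg Prod.snd h)⟩, Subtype.ext ?_⟩
    change powMap n (z * a, a) = _
    rw [powMap_of_snd_ne_zero ha, mul_div_cancel_right₀ _ ha]

theorem isQuotientMap_collarPowMap (hn : n ≠ 0) : Topology.IsQuotientMap (collarPowMap n) := by
  refine (Topology.isQuotientMap_iff _).2 ⟨Topology.isCoinducing_iff.2 fun W =>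
    ⟨fun hW => ?_, fun hW => hW.preimage continuous_collarPowMap⟩, surjective_collarPowMap hn⟩
  rw [← Set.preimage_image_eq W Subtype.val_injective]
  refine IsOpen.preimage continuous_subtype_val (isOpen_iff.2 ⟨?_, ?_⟩)
  · refine isOpen_preimage_of_isOpen_powMap_preimage hn (fun p => ofU_mem_collar)
      (θ := fun a => ⟨(a.2, a.1 * a.2), fun h => a.2.ne_zero (congrArg Prod.fst h)⟩)
      (by fun_prop) (fun a => ?_) hW
    rw [powMap_of_fst_ne_zero a.2.ne_zero]
    simp
  · refine isOpen_preimage_of_isOpen_powMap_preimage hn (fun p => ofV_mem_collar)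
      (θ := fun a => ⟨(a.1 * a.2, a.2), fun h => a.2.ne_zero (congrArg Prod.snd h)⟩)
      (by fun_prop) (fun a => ?_) hW
    rw [powMap_of_snd_ne_zero a.2.ne_zero]
    simp

/-- Equal base coordinates put `p` and `q` on the same complex line, and equal fibre coordinates
make their ratio an `n`-th root of unity. -/
theorem powMap_eq_powMap_iff {p q : ℂ × ℂ} (hp : p ≠ 0) (hq : q ≠ 0) :
    powMap n p = powMap n q ↔ ∃ c : ℂ, c ^ n = 1 ∧ c • q = p := by
  constructor
  · intro h
    by_cases hp1 : p.1 = 0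
    · have hp2 : p.2 ≠ 0 := (fst_ne_zero_or_snd_ne_zero hp).resolve_left (· hp1)
      -- Were `q.2 = 0`, the point would have `z = 0` in the first chart and so would not belong to
      -- the second.
      have hq2 : q.2 ≠ 0 := by
        intro hq2
        have hq1 : q.1 ≠ 0 := (fst_ne_zero_or_snd_ne_zero hq).resolve_right (· hq2)
        rw [powMap_of_snd_ne_zero hp2, powMap_of_fst_ne_zero hq1, eq_comm, ofU_eq_ofV_iff] at h
        exact h.1 (by simp [hq2])
      rw [powMap_of_snd_ne_zero hp2, powMap_of_snd_ne_zero hq2] at h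
      have h' := ofV_injective n h
      rw [Prod.mk.injEq] at h'
      refine ⟨p.2 / q.2, by rw [div_zpow, h'.2, div_self (zpow_ne_zero n hq2)], Prod.ext ?_ ?_⟩
      · have := h'.1
        simp only [Prod.smul_fst, smul_eq_mul]
        field_simp at this ⊢
        linear_combination -this
      · simp [hq2]
    · have hq1 : q.1 ≠ 0 := by
        intro hq1
        have hq2 : q.2 ≠ 0 := (fst_ne_zero_or_snd_ne_zero hq).resolve_left (· hq1)
        rw [powMap_of_fst_ne_zero hp1, powMap_of_snd_ne_zero hq2, ofU_eq_ofV_iff] at h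
        exact h.symm.1 (by simp [hq1])
      rw [powMap_of_fst_ne_zero hp1, powMap_of_fst_ne_zero hq1] at h
      have h' := ofU_injective n h
      rw [Prod.mk.injEq] at h'
      refine ⟨p.1 / q.1, by rw [div_zpow, h'.2, div_self (zpow_ne_zero n hq1)], Prod.ext ?_ ?_⟩
      · simp [hq1]
      · have := h'.1
        simp only [Prod.smul_snd, smul_eq_mul]
        field_simp at this ⊢
        linear_combination -this
  · rintro ⟨c, hc, rfl⟩
    have hc0 : c ≠ 0 := by rintro rfl; simp at hp
    rcases fst_ne_zero_or_snd_ne_zero hq with h | h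
    · rw [powMap_of_fst_ne_zero h, powMap_of_fst_ne_zero (p := c • q) (mul_ne_zero hc0 h)]
      simp [mul_zpow, hc, mul_div_mul_left _ _ hc0]
    · rw [powMap_of_snd_ne_zero h, powMap_of_snd_ne_zero (p := c • q) (mul_ne_zero hc0 h)]
      simp [mul_zpow, hc, mul_div_mul_left _ _ hc0]

theorem zpow_eq_one_iff_pow_natAbs {G : Type*} [Group G] {c : G} :
    c ^ n = 1 ↔ c ^ n.natAbs = 1 := by
  obtain ⟨m, rfl | rfl⟩ := n.eq_nat_or_neg <;> simp

/-- A scalar other than 1 fixes no nonzero vector, so the finite group of roots of unity acts freely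
on a locally compact Hausdorff space. Such an action is properly discontinuous and its quotient map
is a covering. -/
theorem isQuotientCoveringMap_collarPowMap (hn : n ≠ 0) :
    IsQuotientCoveringMap (collarPowMap n) (rootsOfUnity n.natAbs ℂ) := by
  have : NeZero n.natAbs := ⟨Int.natAbs_ne_zero.2 hn⟩
  have : LocallyCompactSpace {p : ℂ × ℂ // p ≠ 0} := isOpen_ne.locallyCompactSpace
  have : ContinuousConstSMul (rootsOfUnity n.natAbs ℂ) {p : ℂ × ℂ // p ≠ 0} :=
    ⟨fun c => Continuous.subtype_mk (continuous_subtype_val.const_smul (c : ℂˣ)) _⟩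
  have : IsCancelSMul (rootsOfUnity n.natAbs ℂ) {p : ℂ × ℂ // p ≠ 0} := by
    refine isCancelSMul_iff_eq_one_of_smul_eq.2 fun c p h => ?_
    have h' : ((c : ℂˣ) : ℂ) • (p : ℂ × ℂ) = p := congrArg Subtype.val h
    have h'' : (((c : ℂˣ) : ℂ) - 1) • (p : ℂ × ℂ) = 0 := by rw [sub_smul, h', one_smul, sub_self]
    exact Subtype.ext (Units.ext (sub_eq_zero.1 ((smul_eq_zero.1 h'').resolve_right p.2)))
  refine (isQuotientMap_collarPowMap hn).isQuotientCoveringMap_of_properlyDiscontinuousSMul ?_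
  intro p q
  rw [collarPowMap, collarPowMap, Subtype.mk.injEq, powMap_eq_powMap_iff p.2 q.2]
  constructor
  · rintro ⟨c, hc, h⟩
    have hc0 : c ≠ 0 := by
      rintro rfl
      exact p.2 (by rw [← h, zero_smul])
    refine ⟨⟨Units.mk0 c hc0, (mem_rootsOfUnity _ _).2
      (zpow_eq_one_iff_pow_natAbs.1 (Units.ext (by simpa using hc)))⟩, Subtype.ext h⟩
  · rintro ⟨c, h⟩
    refine ⟨((c : ℂˣ) : ℂ), ?_, congrArg Subtype.val h⟩
    have := zpow_eq_one_iff_pow_natAbs.2 ((mem_rootsOfUnity _ _).1 c.2)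
    simpa using congrArg Units.val this

theorem nonempty_fundamentalGroup_collar (n : ℤ) (x : collar n) :
    Nonempty (FundamentalGroup (collar n) x ≃* Multiplicative (ZMod n.natAbs)) := by
  rcases eq_or_ne n 0 with rfl | hn
  · exact nonempty_fundamentalGroup_collar_zero x
  have : NeZero n.natAbs := ⟨Int.natAbs_ne_zero.2 hn⟩
  have : SimplyConnectedSpace {p : ℂ × ℂ // p ≠ 0} := simplyConnectedSpace_ne_zero (by
    rw [Module.finrank_prod, Complex.finrank_real_complex]; norm_num)
  have e := (zmodCyclicMulEquiv (inferInstance : IsCyclic (rootsOfUnity n.natAbs ℂ))).symm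
  rw [Complex.card_rootsOfUnity] at e
  exact (isQuotientCoveringMap_collarPowMap hn).nonempty_fundamentalGroup_mulEquiv e x

end LocalSurface

theorem mainTheorem5 (n : ℤ) :
    (∃ (E : Type) (_ : TopologicalSpace E) (p : E → TwoSphere),
      IsCircleBundleOfDegree p n ∧ Nonempty (collar n ≃ₕ E)) ∧
    ∀ x : collar n,
      Nonempty (FundamentalGroup (collar n) x ≃* Multiplicative (ZMod n.natAbs)) :=
  ⟨⟨circleBundle n, inferInstance, LocalSurface.circleProj n,
    LocalSurface.isCircleBundleOfDegree_circleProj n, ⟨LocalSurface.collarHomotopyEquiv n⟩⟩,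
    LocalSurface.nonempty_fundamentalGroup_collar n⟩
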